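/- For a finite graph $F$ let $\mathrm{ex}(n,F)$ be the maximum number of edges of an $n$-vertex graph that does not contain $F$ as a (not necessarily induced) subgraph, let $T_r(n)$ be the balanced complete $r$-partite graph on $n$ vertices (the Turán graph), and let $t_r(n)=e(T_r(n))$, where $e(\cdot)$ denotes the number of edges. Let $r\ge 2$ be an integer and let $F$ be a finite graph with $\mathrm{ex}(n,F)=t_r(n)+O(1)$ as $n\to\infty$. Put $$c_0=\lim_{k\to\infty}\ \sup_{n\ge k}\{\mathrm{ex}(n,F)-t_r(n)\}\in\mathbb Z .$$ Then there is an integer $N$, depending only on $F$ and $r$, such that the following holds for every $n\ge N$ with $\mathrm{ex}(n,F)=t_r(n)+c_0$. If $G$ is an $F$-free graph on $n$ vertices with $e(G)=\mathrm{ex}(n,F)$, then (a) $\mathrm{ex}(n-1,F)=t_r(n-1)+c_0$; (b) there is a partition $V_1,\dots,V_r$ of $V(G)$, unique up to the order of the classes, such that each $V_i$ spans at most $c_0$ edges of $G$. Let $G_0$, $G_{in}$ and $G_{out}$ be the graphs on $V(G)$ whose edges are, respectively, the edges of $G$ between different classes, the edges of $G$ inside the classes, and the pairs of vertices from different classes that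 are not adjacent in $G$. Then moreover (c) the complete $r$-partite graph $T$ with classes $V_1,\dots,V_r$ is isomorphic to $T_r(n)$, and $G=G_0\cup G_{in}$ with $G_0\subseteq T$ and $G_{in}\subseteq \overline{T}$, where $\overline{T}$ is the complement of $T$; (d) $e(G_{in})-e(G_{out})=c_0$; (e) $d_{G_{out}}(v)\le c_0+1$ for every vertex $v\in V(G)$. -/

import Mathlib

open Filter Asymptotics

/-- `t_r(n)`: the number of edges of the Turán graph `T_r(n)`. -/
def turanNum (r n : ℕ) : ℕ := (SimpleGraph.turanGraph n r).edgeFinset.card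

/-- `ex(n, F) = t_r(n) + O(1)` as `n → ∞`. -/
def ExIsTuranPlusO1 {W : Type*} (r : ℕ) (F : SimpleGraph W) : Prop :=
  (fun n : ℕ => (SimpleGraph.extremalNumber n F : ℝ) - (turanNum r n : ℝ))
    =O[atTop] (fun _ : ℕ => (1 : ℝ))

/-- The integer `c₀ = lim_{k → ∞} sup_{n ≥ k} (ex(n, F) - t_r(n))`. The sequence is bounded
whenever `ex(n, F) = t_r(n) + O(1)`, so this is then the genuine upper limit. -/
noncomputable def turanExcess {W : Type*} (r : ℕ) (F : SimpleGraph W) : ℤ :=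
  limsup (fun n : ℕ => (SimpleGraph.extremalNumber n F : ℤ) - (turanNum r n : ℤ)) atTop

/- A partition of the vertex set into `r` labelled classes is a map `p : V → Fin r`, the class
`V_i` being the fibre of `p` over `i`. -/

/-- The complete multipartite graph on `V` whose classes are the fibres of `p`. -/
def multipartiteGraph {V : Type*} {r : ℕ} (p : V → Fin r) : SimpleGraph V :=
  (⊤ : SimpleGraph (Fin r)).comap p

/-- `G_0`: the edges of `G` between different classes. -/
def crossGraph {V : Type*} {r : ℕ} (G : SimpleGraph V) (p : V → Fin r) : SimpleGraph V where
  Adj u v := G.Adj u v ∧ p u ≠ p v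
  symm := ⟨fun _ _ h => ⟨h.1.symm, h.2.symm⟩⟩
  loopless := ⟨fun _ h => h.2 rfl⟩

/-- `G_in`: the edges of `G` with both ends in the same class. -/
def innerGraph {V : Type*} {r : ℕ} (G : SimpleGraph V) (p : V → Fin r) : SimpleGraph V where
  Adj u v := G.Adj u v ∧ p u = p v
  symm := ⟨fun _ _ h => ⟨h.1.symm, h.2.symm⟩⟩
  loopless := ⟨fun _ h => h.1.ne rfl⟩

/-- `G_out`: the pairs of vertices in different classes that are not adjacent in `G`. -/
def missingGraph {V : Type*} {r : ℕ} (G : SimpleGraph V) (p : V → Fin r) : SimpleGraph V where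
  Adj u v := ¬ G.Adj u v ∧ p u ≠ p v
  symm := ⟨fun _ _ h => ⟨fun h' => h.1 h'.symm, h.2.symm⟩⟩
  loopless := ⟨fun _ h => h.2 rfl⟩

/-- Every class `V_i` spans at most `c` edges of `G`, that is `e(V_i) ≤ c` for all `i`. -/
def ClassesSpanAtMost {V : Type*} {r : ℕ} (G : SimpleGraph V) (p : V → Fin r) (c : ℤ) : Prop :=
  ∀ i : Fin r, ((G.induce {v | p v = i}).edgeSet.ncard : ℤ) ≤ c

/-!
The proof rests on one transplantation principle,
`ncard_innerGraph_le_ncard_missingGraph_add`. Suppose that an `F`-free graph `G` contains a finite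
configuration `H` whose vertices are assigned to `r` classes, and for every class `|V(F)|` further
vertices that are joined to everything in the other classes. Plant `H` into a complete `r`-partite
graph with large equal classes, every other cross pair being an edge. A copy of `F` there
could be moved into `G`, so the planted graph is `F`-free and has at most `t_r(n) + c₀` edges.
Hence `e(H_in) - e(H_out) ≤ c₀`. In particular (`LocallySparse`) a set of vertices that could belong
to one class spans at most `c₀` edges.

Let `G` be extremal with `t_r(n) + c₀` edges. Deleting a vertex `v` shows that `v` has at least the
smallest degree of `T_r(n)`, since `ex(n - 1, F) ≤ t_r(n - 1) + c₀`, and averaging shows that some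
vertex has exactly this degree, which gives `ex(n - 1, F) = t_r(n - 1) + c₀`. By the minimum degree
form of the Erdős–Stone theorem, `G` contains a large complete balanced `r`-partite graph, here called a block. By
local sparsity no vertex sees many vertices of every class of the block, so counting the
non-adjacent pairs attaches all but a small proportion of the vertices to one class each
(`mul_card_compl_attached_le`). The sets `B i` of vertices attached to class `i` have bounded degree
inside and about `n / r` vertices each, and cross pairs are nearly complete. The same reasoning,
with the `B i` in place of the block, assigns every remaining vertex to a class, and sets of bounded
size inside a class span at most `c₀` edges; hence so does the whole class
(`exists_partition_of_isBlock`).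

Now `e(G) = e(T) + e(G_in) - e(G_out)` with `e(T) ≤ t_r(n)`, so only boundedly many vertices touch
an inner edge or a missing edge. Transplanting these gives `e(G_in) - e(G_out) ≤ c₀`, so both
inequalities are equalities, and `T` is a Turán graph by Turán's theorem. The bound on the missing
degrees compares the minimum degree with the size of the class, and uniqueness follows because
a class of a second partition that meets `V_i` in many vertices cannot contain a vertex outside
`V_i`.
-/

/-! ### Edge counts relative to a partition -/

section EdgeCount

variable {V : Type*} {r : ℕ} (G : SimpleGraph V) (p : V → Fin r)

theorem crossGraph_sup_innerGraph : crossGraph G p ⊔ innerGraph G p = G := by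
  ext u v
  simp only [SimpleGraph.sup_adj, crossGraph, innerGraph]
  tauto

theorem crossGraph_sup_missingGraph :
    crossGraph G p ⊔ missingGraph G p = multipartiteGraph p := by
  ext u v
  simp only [SimpleGraph.sup_adj, crossGraph, missingGraph, multipartiteGraph,
    SimpleGraph.comap_adj, SimpleGraph.top_adj]
  tauto

theorem innerGraph_le_compl_multipartiteGraph :
    innerGraph G p ≤ (multipartiteGraph p)ᶜ := fun u v h => by
  simpa [multipartiteGraph, SimpleGraph.compl_adj, h.2] using h.1.ne

theorem ncard_edgeSet_sup_of_disjoint [Finite V] {A B : SimpleGraph V} (h : Disjoint A B) :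
    (A ⊔ B).edgeSet.ncard = A.edgeSet.ncard + B.edgeSet.ncard := by
  rw [SimpleGraph.edgeSet_sup]
  exact Set.ncard_union_eq (SimpleGraph.disjoint_edgeSet.2 h)

/-- `e(G) + e(G_out) = e(T) + e(G_in)`, where `T` is the complete multipartite graph of `p`. -/
theorem ncard_edgeSet_add_missingGraph [Finite V] :
    G.edgeSet.ncard + (missingGraph G p).edgeSet.ncard
      = (multipartiteGraph p).edgeSet.ncard + (innerGraph G p).edgeSet.ncard := by
  have h1 : Disjoint (crossGraph G p) (innerGraph G p) := by
    rw [SimpleGraph.disjoint_left]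
    exact fun u v h h' => h.2 h'.2
  have h2 : Disjoint (crossGraph G p) (missingGraph G p) := by
    rw [SimpleGraph.disjoint_left]
    exact fun u v h h' => h'.1 h.1
  have h3 := ncard_edgeSet_sup_of_disjoint h1
  have h4 := ncard_edgeSet_sup_of_disjoint h2
  rw [crossGraph_sup_innerGraph] at h3
  rw [crossGraph_sup_missingGraph] at h4
  omega

theorem ncard_edgeSet_map {S : Type*} (f : S ↪ V) (H : SimpleGraph S) :
    (H.map f).edgeSet.ncard = H.edgeSet.ncard := by
  rw [SimpleGraph.edgeSet_map]
  exact Set.ncard_image_of_injective _ f.sym2Map.injective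

theorem ncard_edgeSet_le_extremalNumber [Fintype V] {W : Type*} {F : SimpleGraph W}
    (h : F.Free G) : G.edgeSet.ncard ≤ SimpleGraph.extremalNumber (Fintype.card V) F := by
  classical
  have := SimpleGraph.card_edgeFinset_le_extremalNumber h
  rwa [SimpleGraph.edgeFinset, ← Set.ncard_eq_toFinset_card'] at this

theorem turanNum_eq_ncard (r n : ℕ) :
    turanNum r n = (SimpleGraph.turanGraph n r).edgeSet.ncard := by
  rw [turanNum, SimpleGraph.edgeFinset, ← Set.ncard_eq_toFinset_card']

theorem ncard_edgeSet_eq_of_iso {V' : Type*} {G : SimpleGraph V} {G' : SimpleGraph V'}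
    (e : G ≃g G') : G.edgeSet.ncard = G'.edgeSet.ncard :=
  Set.ncard_congr' e.mapEdgeSet

end EdgeCount

/-! ### Transplanting a bounded configuration into a balanced multipartite graph -/

section Core

variable {V S W : Type*} {r : ℕ}

/-- The graph on `r` classes of size `K` that carries a copy of `H` on the image of `φ` and in
which every other pair of vertices from different classes is adjacent. -/
def plantedGraph {K : ℕ} (H : SimpleGraph S) (φ : S ↪ Fin r × Fin K) :
    SimpleGraph (Fin r × Fin K) where
  Adj x y := (∃ a b, φ a = x ∧ φ b = y ∧ H.Adj a b) ∨
    (x.1 ≠ y.1 ∧ ¬ ∃ a b, φ a = x ∧ φ b = y)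
  symm := ⟨by
    rintro x y (⟨a, b, ha, hb, h⟩ | ⟨h, h'⟩)
    · exact Or.inl ⟨b, a, hb, ha, h.symm⟩
    · exact Or.inr ⟨h.symm, fun ⟨a, b, ha, hb⟩ => h' ⟨b, a, hb, ha⟩⟩⟩
  loopless := ⟨fun x => by
    rintro (⟨a, b, ha, hb, h⟩ | ⟨h, -⟩)
    · exact h.ne (φ.injective (ha.trans hb.symm))
    · exact h rfl⟩

/-- If `G` contains `H` together with vertices `ρ i w`, for `i` a class and `w` a vertex of `F`,
that are joined to everything in the other classes, then a copy of `F` in the planted graph of `H`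
can be moved into `G`: keep the vertices of `H` and send the others to the `ρ i w`. -/
theorem plantedGraph_free {K : ℕ} {F : SimpleGraph W} {G : SimpleGraph V} (hG : F.Free G)
    {H : SimpleGraph S} {p : S → Fin r} (φ : S ↪ Fin r × Fin K) (hφ : ∀ s, (φ s).1 = p s)
    {f : S → V} (hf : Function.Injective f) (hHG : ∀ a b, H.Adj a b → G.Adj (f a) (f b))
    {ρ : Fin r → W → V} (hρ : ∀ i, Function.Injective (ρ i))
    (hρρ : ∀ i j w w', i ≠ j → G.Adj (ρ i w) (ρ j w')) (hρf : ∀ i w s, ρ i w ≠ f s)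
    (hρS : ∀ i w s, i ≠ p s → G.Adj (ρ i w) (f s)) : F.Free (plantedGraph H φ) := by
  classical
  rintro ⟨g⟩
  apply hG
  -- the image of `w` is described by cases, according to whether `g w` lies in the copy of `H`
  have key : ∀ w, ∃ v, (∃ s, φ s = g w ∧ v = f s) ∨
      ((¬ ∃ s, φ s = g w) ∧ v = ρ (g w).1 w) := fun w => by
    by_cases h : ∃ s, φ s = g w
    · obtain ⟨s, hs⟩ := h
      exact ⟨f s, Or.inl ⟨s, hs, rfl⟩⟩
    · exact ⟨_, Or.inr ⟨h, rfl⟩⟩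
  choose h hh using key
  refine ⟨⟨⟨h, fun {u v} huv => ?_⟩, fun u v huv => ?_⟩⟩
  · have hadj : (plantedGraph H φ).Adj (g u) (g v) := g.toHom.map_adj huv
    rcases hh u with ⟨s, hs, hu⟩ | ⟨hs, hu⟩ <;> rcases hh v with ⟨t, ht, hv⟩ | ⟨ht, hv⟩ <;>
      rw [hu, hv] <;> rcases hadj with ⟨a, b, ha, hb, hab⟩ | ⟨hne, hnot⟩
    · obtain rfl := φ.injective (ha.trans hs.symm)
      obtain rfl := φ.injective (hb.trans ht.symm)
      exact hHG _ _ hab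
    · exact absurd ⟨s, t, hs, ht⟩ hnot
    · exact absurd ⟨b, hb⟩ ht
    · refine (hρS _ _ _ ?_).symm
      rw [← hφ s, hs]
      exact hne.symm
    · exact absurd ⟨a, ha⟩ hs
    · refine hρS _ _ _ ?_
      rw [← hφ t, ht]
      exact hne
    · exact absurd ⟨b, hb⟩ ht
    · exact hρρ _ _ _ _ hne
  · change h u = h v at huv
    rcases hh u with ⟨s, hs, hu⟩ | ⟨hs, hu⟩ <;> rcases hh v with ⟨t, ht, hv⟩ | ⟨ht, hv⟩ <;>
      rw [hu, hv] at huv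
    · obtain rfl := hf huv
      exact g.injective (hs.symm.trans ht)
    · exact absurd huv.symm (hρf _ _ _)
    · exact absurd huv (hρf _ _ _)
    · by_cases hc : (g u).1 = (g v).1
      · rw [hc] at huv
        exact hρ _ huv
      · exact absurd huv (hρρ _ _ _ _ hc).ne

theorem innerGraph_plantedGraph {K : ℕ} (H : SimpleGraph S) {p : S → Fin r}
    (φ : S ↪ Fin r × Fin K) (hφ : ∀ s, (φ s).1 = p s) :
    innerGraph (plantedGraph H φ) Prod.fst = (innerGraph H p).map φ := by
  ext x y
  simp only [innerGraph, plantedGraph, SimpleGraph.map_adj]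
  constructor
  · rintro ⟨⟨a, b, rfl, rfl, h⟩ | ⟨h, -⟩, h'⟩
    · exact ⟨a, b, ⟨h, by rwa [hφ, hφ] at h'⟩, rfl, rfl⟩
    · exact absurd h' h
  · rintro ⟨a, b, ⟨h, h'⟩, rfl, rfl⟩
    exact ⟨Or.inl ⟨a, b, rfl, rfl, h⟩, by rwa [hφ, hφ]⟩

theorem missingGraph_plantedGraph {K : ℕ} (H : SimpleGraph S) {p : S → Fin r}
    (φ : S ↪ Fin r × Fin K) (hφ : ∀ s, (φ s).1 = p s) :
    missingGraph (plantedGraph H φ) Prod.fst = (missingGraph H p).map φ := by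
  ext x y
  simp only [missingGraph, plantedGraph, SimpleGraph.map_adj]
  constructor
  · rintro ⟨h, h'⟩
    rw [not_or, not_and_not_right] at h
    obtain ⟨a, b, rfl, rfl⟩ := h.2 h'
    exact ⟨a, b, ⟨fun hab => h.1 ⟨a, b, rfl, rfl, hab⟩, by rwa [hφ, hφ] at h'⟩, rfl, rfl⟩
  · rintro ⟨a, b, ⟨h, h'⟩, rfl, rfl⟩
    refine ⟨?_, by rwa [hφ, hφ]⟩
    rintro (⟨a', b', ha, hb, hab⟩ | ⟨-, h⟩)
    · rw [φ.injective ha, φ.injective hb] at hab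
      exact h hab
    · exact h ⟨a, b, rfl, rfl⟩

theorem ncard_edgeSet_multipartiteGraph_fst (r K : ℕ) :
    (multipartiteGraph (Prod.fst : Fin r × Fin K → Fin r)).edgeSet.ncard = turanNum r (r * K) := by
  rw [turanNum_eq_ncard]
  exact ncard_edgeSet_eq_of_iso SimpleGraph.completeEquipartiteGraph.turanGraph

/-- If an `F`-free graph contains `H` together with sufficiently many vertices in every class that
are joined to everything in the other classes, then `e(H_in) ≤ e(H_out) + c`, where
`c` bounds `ex(n, F) - t_r(n)` for all large `n`: planting `H` into a large Turán graph yields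
an `F`-free graph. -/
theorem ncard_innerGraph_le_ncard_missingGraph_add [Finite S] {F : SimpleGraph W} {n₀ : ℕ}
    {c : ℤ} (hr : 0 < r)
    (hex : ∀ n, n₀ ≤ n → (SimpleGraph.extremalNumber n F : ℤ) ≤ turanNum r n + c)
    {G : SimpleGraph V} (hG : F.Free G) {H : SimpleGraph S} (p : S → Fin r)
    {f : S → V} (hf : Function.Injective f) (hHG : ∀ a b, H.Adj a b → G.Adj (f a) (f b))
    {ρ : Fin r → W → V} (hρ : ∀ i, Function.Injective (ρ i))
    (hρρ : ∀ i j w w', i ≠ j → G.Adj (ρ i w) (ρ j w')) (hρf : ∀ i w s, ρ i w ≠ f s)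
    (hρS : ∀ i w s, i ≠ p s → G.Adj (ρ i w) (f s)) :
    ((innerGraph H p).edgeSet.ncard : ℤ) ≤ (missingGraph H p).edgeSet.ncard + c := by
  have := Fintype.ofFinite S
  let K := max n₀ (Fintype.card S)
  obtain ⟨e⟩ : Nonempty (S ↪ Fin K) :=
    Function.Embedding.nonempty_of_card_le (by simp [K])
  let φ : S ↪ Fin r × Fin K := ⟨fun s => (p s, e s), fun s t h => e.injective (Prod.ext_iff.1 h).2⟩
  have hφ : ∀ s, (φ s).1 = p s := fun _ => rfl
  have h1 := ncard_edgeSet_le_extremalNumber _ (plantedGraph_free hG φ hφ hf hHG hρ hρρ hρf hρS)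
  have h2 := ncard_edgeSet_add_missingGraph (plantedGraph H φ) Prod.fst
  rw [innerGraph_plantedGraph H φ hφ, missingGraph_plantedGraph H φ hφ, ncard_edgeSet_map,
    ncard_edgeSet_map, ncard_edgeSet_multipartiteGraph_fst] at h2
  rw [Fintype.card_prod, Fintype.card_fin, Fintype.card_fin] at h1
  have h3 := hex (r * K) ((le_max_left _ _).trans (Nat.le_mul_of_pos_left K hr))
  omega

end Core

/-! ### Blocks and greedy embedding -/

section Block

variable {V : Type*} {r : ℕ}

/-- The vertices `a i x` span a (not necessarily induced) complete `r`-partite graph in `G` with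
classes `{a i x | x}` of size `|X|`. -/
def IsBlock {X : Type*} (G : SimpleGraph V) (a : Fin r → X → V) : Prop :=
  (∀ i, Function.Injective (a i)) ∧ ∀ i j x y, i ≠ j → G.Adj (a i x) (a j y)

/-- A set of vertices all of which could belong to the same class `i` of a complete `r`-partite
subgraph with classes of size `w` outside that set spans at most `c` edges. -/
def LocallySparse (G : SimpleGraph V) (r w c : ℕ) : Prop :=
  ∀ (S : Finset V) (i : Fin r) (ρ : Fin r → Fin w → V), IsBlock G ρ → (∀ j x, ρ j x ∉ S) →
    (∀ j x, j ≠ i → ∀ s ∈ S, G.Adj (ρ j x) s) → (G.induce (S : Set V)).edgeSet.ncard ≤ c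

theorem IsBlock.exists_restrict {X : Type*} {G : SimpleGraph V} {a : Fin r → X → V}
    (ha : IsBlock G a) {Y : Fin r → Finset X} {w : ℕ} (hY : ∀ i, w ≤ (Y i).card) :
    ∃ ρ : Fin r → Fin w → V, IsBlock G ρ ∧ ∀ i x, ∃ y ∈ Y i, ρ i x = a i y := by
  have key : ∀ i, Nonempty (Fin w ↪ Y i) := fun i =>
    Function.Embedding.nonempty_of_card_le (by simpa using hY i)
  let e := fun i => (key i).some
  exact ⟨fun i x => a i (e i x),
    ⟨fun i x y h => (e i).injective (Subtype.ext (ha.1 i h)), fun i j x y h => ha.2 i j _ _ h⟩,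
    fun i x => ⟨e i x, (e i x).2, rfl⟩⟩

/-- Greedy choice of pairwise compatible representatives. -/
theorem exists_pairwise_of_card_le {ι : Type*} [Fintype ι] {good : ι → ι → V → V → Prop}
    (hsymm : ∀ i j x y, good i j x y → good j i y x) (C : ι → Finset V) (D : ℕ)
    (hD : ∀ i j, i ≠ j → ∀ x ∈ C i, ∀ B ⊆ C j, (∀ y ∈ B, ¬ good i j x y) → B.card ≤ D)
    (hC : ∀ i, Fintype.card ι * D ≤ (C i).card) (hD0 : 0 < D) :
    ∃ ρ : ι → V, (∀ i, ρ i ∈ C i) ∧ ∀ i j, i ≠ j → good i j (ρ i) (ρ j) := by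
  classical
  have key : ∀ T : Finset ι, ∃ ρ : ι → V, (∀ i ∈ T, ρ i ∈ C i) ∧
      ∀ i ∈ T, ∀ j ∈ T, i ≠ j → good i j (ρ i) (ρ j) := by
    intro T
    induction T using Finset.induction_on with
    | empty =>
      by_cases h : Nonempty ι
      · obtain ⟨i⟩ := h
        have : 0 < (C i).card :=
          lt_of_lt_of_le (Nat.mul_pos (Fintype.card_pos_iff.2 ⟨i⟩) hD0) (hC i)
        obtain ⟨x, -⟩ := Finset.card_pos.1 this
        exact ⟨fun _ => x, by simp, by simp⟩
      · exact ⟨fun i => (h ⟨i⟩).elim, by simp, by simp⟩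
    | insert k T hk ih =>
      obtain ⟨ρ, h1, h2⟩ := ih
      let B : ι → Finset V := fun i => (C k).filter fun y => ¬ good i k (ρ i) y
      have hB : (T.biUnion B).card < (C k).card := by
        calc (T.biUnion B).card ≤ T.card * D := by
              refine Finset.card_biUnion_le_card_mul _ _ _ fun i hi => ?_
              refine hD i k (fun h => hk (h ▸ hi)) _ (h1 i hi) _ (Finset.filter_subset _ _) ?_
              intro y hy
              exact (Finset.mem_filter.1 hy).2
          _ < Fintype.card ι * D := by
              refine Nat.mul_lt_mul_of_pos_right ?_ hD0
              have := Finset.card_le_univ (insert k T)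
              rw [Finset.card_insert_of_notMem hk] at this
              omega
          _ ≤ _ := hC k
      obtain ⟨y, hy, hy'⟩ := Finset.exists_mem_notMem_of_card_lt_card hB
      have hgood : ∀ i ∈ T, good i k (ρ i) y := by
        intro i hi
        by_contra hcon
        exact hy' (Finset.mem_biUnion.2 ⟨i, hi, Finset.mem_filter.2 ⟨hy, hcon⟩⟩)
      have hne : ∀ i ∈ T, i ≠ k := fun i hi h => hk (h ▸ hi)
      refine ⟨Function.update ρ k y, fun i hi => ?_, fun i hi j hj hij => ?_⟩
      · rcases Finset.mem_insert.1 hi with rfl | hi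
        · simpa using hy
        · simpa [hne i hi] using h1 i hi
      · rcases Finset.mem_insert.1 hi with rfl | hi' <;>
          rcases Finset.mem_insert.1 hj with rfl | hj'
        · exact absurd rfl hij
        · simpa [hne j hj'] using hsymm _ _ _ _ (hgood j hj')
        · simpa [hne i hi'] using hgood i hi'
        · simpa [hne i hi', hne j hj'] using h2 i hi' j hj' hij
  obtain ⟨ρ, h1, h2⟩ := key Finset.univ
  exact ⟨ρ, fun i => h1 i (Finset.mem_univ i),
    fun i j => h2 i (Finset.mem_univ i) j (Finset.mem_univ j)⟩

/-- If every vertex of `C i` misses only a few vertices of `C j` for `i ≠ j`, then the sets `C i`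
contain the classes of a block. -/
theorem exists_isBlock_of_card_le (G : SimpleGraph V) [DecidableRel G.Adj] (C : Fin r → Finset V)
    (D L : ℕ) (hD : ∀ i j, i ≠ j → ∀ x ∈ C i, ((C j).filter fun y => ¬ G.Adj x y).card ≤ D)
    (hC : ∀ i, r * L * (D + 1) ≤ (C i).card) :
    ∃ a : Fin r → Fin L → V, IsBlock G a ∧ ∀ i x, a i x ∈ C i := by
  classical
  obtain ⟨ρ, h1, h2⟩ := exists_pairwise_of_card_le (ι := Fin r × Fin L)
    (good := fun i j x y => x ≠ y ∧ (i.1 ≠ j.1 → G.Adj x y))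
    (fun i j x y h => ⟨h.1.symm, fun hij => (h.2 hij.symm).symm⟩) (fun i => C i.1) (D + 1)
    (fun i j _ x hx B hB hbad => by
      by_cases hij : i.1 = j.1
      · have : B ⊆ {x} := fun y hy => by
          have := hbad y hy
          simp only [hij, ne_eq, not_true_eq_false, false_imp_iff, and_true, not_not] at this
          simp [this]
        exact (Finset.card_le_card this).trans (by simp)
      · refine (Finset.card_le_card (fun y hy => ?_)).trans ((hD i.1 j.1 hij x hx).trans (by omega))
        refine Finset.mem_filter.2 ⟨hB hy, fun hxy => hbad y hy ⟨hxy.ne, fun _ => hxy⟩⟩)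
    (fun i => by simpa using hC i.1) (Nat.succ_pos D)
  refine ⟨fun i x => ρ (i, x), ⟨fun i x y hxy => ?_, fun i j x y hij => ?_⟩, fun i x => h1 _⟩
  · by_contra hne
    exact (h2 (i, x) (i, y) (by simpa using hne)).1 hxy
  · exact (h2 (i, x) (j, y) (fun h => hij (Prod.ext_iff.1 h).1)).2 hij

theorem ncard_edgeSet_induce (G : SimpleGraph V) (s : Set V) :
    (G.induce s).edgeSet.ncard = {e ∈ G.edgeSet | ∀ x ∈ e, x ∈ s}.ncard := by
  rw [← Set.ncard_image_of_injective _ (Sym2.map.injective Subtype.val_injective)]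
  congr 1
  ext e
  induction e with | _ x y
  simp only [Set.mem_image, Set.mem_ofPred_eq, SimpleGraph.mem_edgeSet, Sym2.mem_iff,
    forall_eq_or_imp, forall_eq]
  constructor
  · rintro ⟨e, he, hxy⟩
    induction e with | _ a b
    rw [Sym2.map_mk, Sym2.eq_iff] at hxy
    rcases hxy with ⟨rfl, rfl⟩ | ⟨rfl, rfl⟩
    · exact ⟨he, a.2, b.2⟩
    · exact ⟨SimpleGraph.Adj.symm he, b.2, a.2⟩
  · rintro ⟨h, hx, hy⟩
    exact ⟨s(⟨x, hx⟩, ⟨y, hy⟩), h, rfl⟩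

theorem card_le_ncard_edgeSet_induce [Finite V] (G : SimpleGraph V) {s : Set V} {T : Finset V}
    {v : V} (hv : v ∈ s) (hT : ∀ u ∈ T, u ∈ s) (hvT : ∀ u ∈ T, G.Adj v u) :
    T.card ≤ (G.induce s).edgeSet.ncard := by
  rw [ncard_edgeSet_induce, ← Set.ncard_coe_finset]
  refine Set.ncard_le_ncard_of_injOn (fun u => s(v, u)) (fun u hu => ⟨hvT u hu, ?_⟩)
    (fun u _ u' _ h => Sym2.congr_right.1 h)
  simp only [Sym2.mem_iff, forall_eq_or_imp, forall_eq]
  exact ⟨hv, hT u hu⟩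

/-- More than `c` edges inside a set can be witnessed by at most `2 * (c + 1)` vertices. -/
theorem exists_finset_ncard_edgeSet_induce_gt [Finite V] (G : SimpleGraph V) {s : Set V} {c : ℕ}
    (h : c < (G.induce s).edgeSet.ncard) :
    ∃ S : Finset V, (∀ v ∈ S, v ∈ s) ∧ S.card ≤ 2 * (c + 1) ∧
      c < (G.induce (S : Set V)).edgeSet.ncard := by
  classical
  rw [ncard_edgeSet_induce] at h
  obtain ⟨A, hA, hAc⟩ := Set.exists_subset_card_eq (Nat.succ_le_of_lt h)
  lift A to Finset (Sym2 V) using Set.toFinite A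
  rw [Set.ncard_coe_finset] at hAc
  refine ⟨A.biUnion Sym2.toFinset, fun v hv => ?_, ?_, ?_⟩
  · obtain ⟨e, he, hve⟩ := Finset.mem_biUnion.1 hv
    exact (hA he).2 v (Sym2.mem_toFinset.1 hve)
  · rw [mul_comm, ← Nat.succ_eq_add_one, ← hAc]
    refine Finset.card_biUnion_le_card_mul _ _ _ fun e _ => ?_
    rw [Sym2.card_toFinset]
    split_ifs <;> omega
  · rw [ncard_edgeSet_induce, ← Nat.succ_le_iff, ← hAc, ← Set.ncard_coe_finset]
    refine Set.ncard_le_ncard fun e he => ⟨(hA he).1, fun x hx => ?_⟩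
    exact Finset.mem_biUnion.2 ⟨e, he, Sym2.mem_toFinset.2 hx⟩

/-- No vertex is joined to all of a block with classes of size `w + c + 1`: it would be the centre
of a star with `c + 1` leaves. -/
theorem LocallySparse.not_forall_adj [Finite V] {G : SimpleGraph V} {w c : ℕ}
    (hG : LocallySparse G r w c) (hr : 0 < r) {a : Fin r → Fin (w + c + 1) → V}
    (ha : IsBlock G a) {v : V} (hv : ∀ i x, G.Adj v (a i x)) : False := by
  classical
  let i₀ : Fin r := ⟨0, hr⟩
  let T : Finset V := Finset.univ.image fun y : Fin (c + 1) => a i₀ (Fin.natAdd w y)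
  have hT : T.card = c + 1 := by
    rw [Finset.card_image_of_injective, Finset.card_univ, Fintype.card_fin]
    exact (ha.1 i₀).comp (Fin.natAdd_injective _ _)
  have hmem : ∀ s ∈ T, ∃ y : Fin (c + 1), a i₀ (Fin.natAdd w y) = s := by simp [T]
  have h := hG (insert v T) i₀ (fun i x => a i (Fin.castAdd (c + 1) x))
    ⟨fun i => (ha.1 i).comp (Fin.castAdd_injective _ _), fun i j x y h => ha.2 i j _ _ h⟩
    (fun j x hx => by
      rcases Finset.mem_insert.1 hx with h | h
      · exact (hv j _).ne h.symm
      · obtain ⟨y, hy⟩ := hmem _ h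
        by_cases hj : i₀ = j
        · subst hj
          have := congrArg Fin.val ((ha.1 _) hy)
          simp at this
          omega
        · exact (ha.2 _ _ _ _ hj).ne hy)
    (fun j x hj s hs => by
      rcases Finset.mem_insert.1 hs with rfl | h
      · exact (hv j _).symm
      · obtain ⟨y, rfl⟩ := hmem _ h
        exact ha.2 _ _ _ _ hj)
  have h2 := card_le_ncard_edgeSet_induce G (s := (insert v T : Finset V))
    (Finset.mem_insert_self v T) (fun u => Finset.mem_insert_of_mem)
    (fun u hu => by obtain ⟨y, rfl⟩ := hmem _ hu; exact hv _ _)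
  omega

end Block

/-! ### From a block to a partition into sparse classes -/

section Partition

variable {V : Type*} [Fintype V] {r : ℕ} {G : SimpleGraph V} [DecidableRel G.Adj]

/-- The vertices attached to class `i` of the block `a`: they are adjacent to fewer than `L`
vertices of that class and non-adjacent to at most `τ` vertices of any other class. -/
def attached {t : ℕ} (G : SimpleGraph V) [DecidableRel G.Adj] (a : Fin r → Fin t → V) (L τ : ℕ)
    (i : Fin r) : Finset V :=
  Finset.univ.filter fun v => t < (Finset.univ.filter fun x => ¬ G.Adj v (a i x)).card + L ∧
    ∀ j, j ≠ i → (Finset.univ.filter fun x => ¬ G.Adj v (a j x)).card ≤ τ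

theorem disjoint_attached {t : ℕ} (a : Fin r → Fin t → V) {L τ : ℕ} (ht : τ + L ≤ t)
    {i j : Fin r} (hij : i ≠ j) : Disjoint (attached G a L τ i) (attached G a L τ j) := by
  rw [Finset.disjoint_left]
  intro v hi hj
  have h1 := (Finset.mem_filter.1 hi).2.1
  have h2 := (Finset.mem_filter.1 hj).2.2 i hij
  omega

variable [DecidableEq V]

/-- A vertex attached to class `i` with `c + 1` neighbours attached to class `i` would form a star
whose vertices have many common neighbours in all other classes of the block. -/
theorem card_adj_attached_le {w c t L τ : ℕ} (hG : LocallySparse G r w c)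
    {a : Fin r → Fin t → V} (ha : IsBlock G a) (hτ : 1 ≤ τ) (ht : (c + 2) * τ + w ≤ t)
    {i : Fin r} {v : V} (hv : v ∈ attached G a L τ i) :
    ((attached G a L τ i).filter fun u => G.Adj v u).card ≤ c := by
  by_contra! hcon
  obtain ⟨T, hT, hTc⟩ := Finset.exists_subset_card_eq (Nat.succ_le_of_lt hcon)
  have hTi : ∀ u ∈ insert v T, u ∈ attached G a L τ i := fun u hu => by
    rcases Finset.mem_insert.1 hu with rfl | hu
    · exact hv
    · exact (Finset.mem_filter.1 (hT hu)).1
  have hSc : (insert v T).card ≤ c + 2 := (Finset.card_insert_le _ _).trans (by omega)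
  let bad : Fin r → Finset (Fin t) := fun j =>
    if j = i then Finset.univ.filter fun x => a j x ∈ insert v T
    else (insert v T).biUnion fun s => Finset.univ.filter fun x => ¬ G.Adj s (a j x)
  have hbad : ∀ j, (bad j).card ≤ (c + 2) * τ := by
    intro j
    by_cases hj : j = i
    · simp only [bad, hj, if_true]
      calc _ ≤ (insert v T).card :=
            Finset.card_le_card_of_injOn (a i) (fun x hx => (Finset.mem_filter.1 hx).2)
              (ha.1 i).injOn
        _ ≤ c + 2 := hSc
        _ ≤ (c + 2) * τ := Nat.le_mul_of_pos_right _ hτ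
    · simp only [bad, hj, if_false]
      refine (Finset.card_biUnion_le_card_mul _ _ τ fun s hs => ?_).trans
        (Nat.mul_le_mul_right _ hSc)
      exact (Finset.mem_filter.1 (hTi s hs)).2.2 j hj
  obtain ⟨ρ, hρ, hρa⟩ := ha.exists_restrict (Y := fun j => (bad j)ᶜ) (w := w) (fun j => by
    rw [Finset.card_compl, Fintype.card_fin]
    have := hbad j
    omega)
  have hadj : ∀ j x, j ≠ i → ∀ s ∈ insert v T, G.Adj (ρ j x) s := by
    intro j x hj s hs
    obtain ⟨y, hy, hyx⟩ := hρa j x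
    rw [hyx]
    by_contra hns
    refine Finset.mem_compl.1 hy ?_
    simp only [bad, hj, if_false]
    exact Finset.mem_biUnion.2 ⟨s, hs, by simpa [G.adj_comm] using hns⟩
  have h := hG (insert v T) i ρ hρ (fun j x hx => by
    by_cases hj : j = i
    · obtain ⟨y, hy, hyx⟩ := hρa j x
      refine Finset.mem_compl.1 hy ?_
      simp only [bad, hj, if_true]
      rw [hyx, hj] at hx
      exact Finset.mem_filter.2 ⟨Finset.mem_univ _, hx⟩
    · exact (hadj j x hj _ hx).ne rfl) hadj
  have h2 := card_le_ncard_edgeSet_induce G (s := (insert v T : Finset V))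
    (Finset.mem_insert_self v T) (fun u => Finset.mem_insert_of_mem)
    (fun u hu => (Finset.mem_filter.1 (hT hu)).2)
  omega

/-- All but few vertices are attached to a class of the block: by double counting the
non-adjacent pairs between the block and the vertex set. -/
theorem mul_card_compl_attached_le {w c t τ : ℕ} (hG : LocallySparse G r w c) (hr : 0 < r)
    {a : Fin r → Fin t → V} (ha : IsBlock G a)
    (hdeg : ∀ v, r * (Finset.univ.filter fun u => ¬ G.Adj v u).card ≤ Fintype.card V + r) :
    τ * (Finset.univ.biUnion (attached G a (w + c + 1) τ))ᶜ.card
      ≤ Fintype.card V * (w + c + 1) + t * r := by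
  set L := w + c + 1 with hL
  set bad := (Finset.univ.biUnion (attached G a L τ))ᶜ with hbad
  let m : Fin r → V → ℕ := fun i v => (Finset.univ.filter fun x => ¬ G.Adj v (a i x)).card
  have hm : ∀ i v, m i v = (Finset.univ.filter fun x => ¬ G.Adj v (a i x)).card := fun _ _ => rfl
  have h1 : ∀ v, ∃ i, t < m i v + L := by
    intro v
    by_contra! hcon
    obtain ⟨ρ, hρ, hρa⟩ := ha.exists_restrict
      (Y := fun i => Finset.univ.filter fun x => G.Adj v (a i x)) (w := w + c + 1) (fun i => by
        have := Finset.card_filter_add_card_filter_not (s := (Finset.univ : Finset (Fin t)))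
          (fun x => G.Adj v (a i x))
        rw [Finset.card_univ, Fintype.card_fin] at this
        have h2 := hcon i
        rw [hm] at h2
        omega)
    refine hG.not_forall_adj hr hρ (v := v) fun i x => ?_
    obtain ⟨y, hy, hyx⟩ := hρa i x
    rw [hyx]
    exact (Finset.mem_filter.1 hy).2
  have h2 : ∀ v, t + (if v ∈ bad then τ else 0) ≤ ∑ i, m i v + L := by
    intro v
    obtain ⟨i, hi⟩ := h1 v
    split_ifs with hv
    · have hvi : v ∉ attached G a L τ i := fun h =>
        Finset.mem_compl.1 hv (Finset.mem_biUnion.2 ⟨i, Finset.mem_univ i, h⟩)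
      simp only [attached, Finset.mem_filter, Finset.mem_univ, true_and, not_and, not_forall,
        not_le] at hvi
      obtain ⟨j, hj, hjτ⟩ := hvi hi
      have h3 : m i v + m j v ≤ ∑ i, m i v := by
        rw [← Finset.sum_pair (f := fun i => m i v) hj.symm]
        exact Finset.sum_le_sum_of_subset (Finset.subset_univ _)
      rw [← hm] at hjτ
      omega
    · have h3 : m i v ≤ ∑ i, m i v :=
        Finset.single_le_sum (f := fun i => m i v) (fun _ _ => Nat.zero_le _) (Finset.mem_univ i)
      omega
  have h3 : r * ∑ v, ∑ i, m i v ≤ r * (t * (Fintype.card V + r)) := by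
    have hswap : ∑ v, ∑ i, m i v
        = ∑ i, ∑ x, (Finset.univ.filter fun v => ¬ G.Adj (a i x) v).card := by
      simp only [hm, Finset.card_filter]
      rw [Finset.sum_comm]
      refine Finset.sum_congr rfl fun i _ => ?_
      rw [Finset.sum_comm]
      simp only [G.adj_comm]
    rw [hswap, Finset.mul_sum]
    calc _ ≤ ∑ _i : Fin r, t * (Fintype.card V + r) := by
          refine Finset.sum_le_sum fun i _ => ?_
          rw [Finset.mul_sum]
          refine (Finset.sum_le_sum fun x _ => hdeg (a i x)).trans ?_
          simp
      _ = _ := by simp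
  have h4 := Finset.sum_le_sum fun v (_ : v ∈ Finset.univ) => h2 v
  simp only [Finset.sum_add_distrib, Finset.sum_const, Finset.card_univ, smul_eq_mul] at h4
  rw [Finset.sum_ite_mem, Finset.univ_inter, Finset.sum_const, smul_eq_mul] at h4
  have h5 := Nat.le_of_mul_le_mul_left h3 hr
  nlinarith

end Partition

/-! ### Extending the partition to the exceptional vertices -/

section Approximate

variable {V : Type*} [Fintype V] [DecidableEq V] {r : ℕ} {G : SimpleGraph V} [DecidableRel G.Adj]

/-- Disjoint sets `B i` spanning graphs of maximum degree at most `c` and covering all but `D`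
vertices: an approximation to the partition of `G`. -/
structure IsApproxPartition (G : SimpleGraph V) [DecidableRel G.Adj] (B : Fin r → Finset V)
    (c D : ℕ) : Prop where
  pairwise_disjoint : ∀ i j, i ≠ j → Disjoint (B i) (B j)
  card_adj_le : ∀ i, ∀ v ∈ B i, ((B i).filter fun u => G.Adj v u).card ≤ c
  card_compl_le : (Finset.univ.biUnion B)ᶜ.card ≤ D

namespace IsApproxPartition

variable {B : Fin r → Finset V} {c D : ℕ}

/-- A vertex of `B i` misses at most `n / r + 1` vertices and sees at most `c` of `B i`, so `B i`
has at most `n / r + 1 + c` vertices. -/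
theorem mul_card_le (hB : IsApproxPartition G B c D)
    (hdeg : ∀ v, r * (Finset.univ.filter fun u => ¬ G.Adj v u).card ≤ Fintype.card V + r)
    (i : Fin r) : r * (B i).card ≤ Fintype.card V + r * (1 + c) := by
  rcases (B i).eq_empty_or_nonempty with h | ⟨v, hv⟩
  · simp [h]
  · have h1 := Finset.card_filter_add_card_filter_not (s := B i) (fun u => G.Adj v u)
    have h2 := hB.card_adj_le i v hv
    have h3 : ((B i).filter fun u => ¬ G.Adj v u).card
        ≤ (Finset.univ.filter fun u => ¬ G.Adj v u).card :=
      Finset.card_le_card (Finset.filter_subset_filter _ (Finset.subset_univ _))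
    have h4 := hdeg v
    nlinarith

/-- As no `B j` is much larger than `n / r`, none is much smaller. -/
theorem card_le_mul_card_add (hB : IsApproxPartition G B c D)
    (hdeg : ∀ v, r * (Finset.univ.filter fun u => ¬ G.Adj v u).card ≤ Fintype.card V + r)
    (hD : r * (1 + c) ≤ D) (i : Fin r) :
    Fintype.card V ≤ r * (B i).card + 2 * r * D := by
  have h1 : Fintype.card V ≤ D + ∑ j, (B j).card := by
    rw [← Finset.card_biUnion fun i _ j _ h => hB.pairwise_disjoint i j h,
      ← Finset.card_compl_add_card (Finset.univ.biUnion B)]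
    exact Nat.add_le_add_right hB.card_compl_le _
  have h2 : r * ∑ j ∈ Finset.univ.erase i, (B j).card ≤ (r - 1) * (Fintype.card V + D) := by
    rw [Finset.mul_sum]
    refine (Finset.sum_le_sum fun j _ => (hB.mul_card_le hdeg j).trans
      (Nat.add_le_add_left hD _)).trans ?_
    simp
  rw [← Finset.add_sum_erase _ _ (Finset.mem_univ i)] at h1
  obtain ⟨q, rfl⟩ : ∃ q, r = q + 1 := ⟨r - 1, by have := i.pos; omega⟩
  simp only [Nat.add_sub_cancel] at h2
  nlinarith

/-- A vertex with few neighbours in `B i` misses about `n / r` vertices there, so the minimum degree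
leaves few non-neighbours in the other sets. -/
theorem card_not_adj_le (hB : IsApproxPartition G B c D)
    (hdeg : ∀ v, r * (Finset.univ.filter fun u => ¬ G.Adj v u).card ≤ Fintype.card V + r)
    (hD : r * (1 + c) ≤ D) {i j : Fin r} (hij : i ≠ j) {v : V} {e : ℕ}
    (hv : ((B i).filter fun u => G.Adj v u).card ≤ e) :
    ((B j).filter fun u => ¬ G.Adj v u).card ≤ 1 + e + 2 * D := by
  have h1 := Finset.card_filter_add_card_filter_not (s := B i) (fun u => G.Adj v u)
  have h2 : ((B i).filter fun u => ¬ G.Adj v u).card + ((B j).filter fun u => ¬ G.Adj v u).card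
      ≤ (Finset.univ.filter fun u => ¬ G.Adj v u).card := by
    rw [← Finset.card_union_of_disjoint (Finset.disjoint_filter_filter
      (hB.pairwise_disjoint i j hij)), ← Finset.filter_union]
    exact Finset.card_le_card (Finset.filter_subset_filter _ (Finset.subset_univ _))
  have h3 := hdeg v
  have h4 := hB.card_le_mul_card_add hdeg hD i
  have hr : 0 < r := i.pos
  have h5 : r * ((B j).filter fun u => ¬ G.Adj v u).card ≤ r * (1 + e + 2 * D) := by
    nlinarith
  exact Nat.le_of_mul_le_mul_left h5 hr

/-- Every vertex has few neighbours in some `B i`, as otherwise its neighbourhood would contain a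
block. -/
theorem exists_card_adj_lt {w : ℕ} (hB : IsApproxPartition G B c D)
    (hG : LocallySparse G r w c) (hr : 0 < r)
    (hdeg : ∀ v, r * (Finset.univ.filter fun u => ¬ G.Adj v u).card ≤ Fintype.card V + r)
    (hD : r * (1 + c) ≤ D) (v : V) :
    ∃ i, ((B i).filter fun u => G.Adj v u).card ≤ r * (w + c + 1) * (1 + c + 2 * D + 1) := by
  by_contra! hcon
  obtain ⟨a, ha, haC⟩ := exists_isBlock_of_card_le G
    (fun i => (B i).filter fun u => G.Adj v u) (1 + c + 2 * D) (w + c + 1)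
    (fun i j hij x hx => by
      have hx := (Finset.mem_filter.1 hx).1
      refine (Finset.card_le_card ?_).trans
        (hB.card_not_adj_le hdeg hD hij (hB.card_adj_le i x hx))
      exact Finset.filter_subset_filter _ (Finset.filter_subset _ _))
    (fun i => (hcon i).le)
  exact hG.not_forall_adj hr ha fun i x => (Finset.mem_filter.1 (haC i x)).2

/-- A set of `k` vertices, all with few neighbours in `B i`, spans at most `c` edges: a block with
classes in the sets `B j` can be found in the common neighbourhood. -/
theorem ncard_edgeSet_induce_le {w e k : ℕ} (hB : IsApproxPartition G B c D)
    (hG : LocallySparse G r w c)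
    (hdeg : ∀ v, r * (Finset.univ.filter fun u => ¬ G.Adj v u).card ≤ Fintype.card V + r)
    (hD : r * (1 + c) ≤ D)
    (hn : 2 * r * D + r * (k * (1 + (1 + e + 2 * D)) + r * w * (1 + c + 2 * D + 1))
      ≤ Fintype.card V) (i : Fin r) {S : Finset V} (hSk : S.card ≤ k)
    (hS : ∀ s ∈ S, ((B i).filter fun u => G.Adj s u).card ≤ e) :
    (G.induce (S : Set V)).edgeSet.ncard ≤ c := by
  have hr : 0 < r := i.pos
  let bad : Fin r → Finset V := fun j =>
    S ∪ if j = i then ∅ else S.biUnion fun s => (B j).filter fun u => ¬ G.Adj s u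
  have hbad : ∀ j, (bad j).card ≤ k * (1 + (1 + e + 2 * D)) := by
    intro j
    refine (Finset.card_union_le _ _).trans ?_
    have : (if j = i then ∅ else S.biUnion fun s => (B j).filter fun u => ¬ G.Adj s u).card
        ≤ k * (1 + e + 2 * D) := by
      split_ifs with hj
      · simp
      · exact (Finset.card_biUnion_le_card_mul _ _ _ fun s hs =>
          hB.card_not_adj_le hdeg hD (Ne.symm hj) (hS s hs)).trans (Nat.mul_le_mul_right _ hSk)
    rw [Nat.mul_add, Nat.mul_one]
    exact Nat.add_le_add hSk this
  obtain ⟨ρ, hρ, hρC⟩ := exists_isBlock_of_card_le G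
    (fun j => B j \ bad j) (1 + c + 2 * D) w
    (fun i j hij x hx => by
      have hx := (Finset.mem_sdiff.1 hx).1
      refine (Finset.card_le_card ?_).trans
        (hB.card_not_adj_le hdeg hD hij (hB.card_adj_le i x hx))
      exact Finset.filter_subset_filter _ Finset.sdiff_subset)
    (fun j => by
      have h1 := Finset.le_card_sdiff (bad j) (B j)
      have h2 := hbad j
      have h3 := hB.card_le_mul_card_add hdeg hD j
      have h4 : r * (k * (1 + (1 + e + 2 * D)) + r * w * (1 + c + 2 * D + 1)) ≤ r * (B j).card := by
        omega
      have h5 := Nat.le_of_mul_le_mul_left h4 hr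
      omega)
  refine hG S i ρ hρ (fun j x hx => ?_) (fun j x hj s hs => ?_)
  · exact (Finset.mem_sdiff.1 (hρC j x)).2 (Finset.mem_union_left _ hx)
  · by_contra hns
    have h := Finset.mem_sdiff.1 (hρC j x)
    refine h.2 (Finset.mem_union_right _ ?_)
    rw [if_neg hj]
    exact Finset.mem_biUnion.2 ⟨s, hs, Finset.mem_filter.2 ⟨h.1, by simpa [G.adj_comm] using hns⟩⟩

end IsApproxPartition

/-- A locally sparse graph of minimum degree `(1 - 1/r)n - O(1)` that contains a large block has a
partition into `r` classes in which small sets span at most `c` edges. -/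
theorem exists_partition_of_isBlock (r w c k : ℕ) (hr : 0 < r) :
    ∃ t N : ℕ, ∀ (V : Type*) [Fintype V] [DecidableEq V] (G : SimpleGraph V) [DecidableRel G.Adj]
      (a : Fin r → Fin t → V), N ≤ Fintype.card V → LocallySparse G r w c → IsBlock G a →
      (∀ v, r * (Finset.univ.filter fun u => ¬ G.Adj v u).card ≤ Fintype.card V + r) →
      ∃ p : V → Fin r, ∀ i (S : Finset V), S.card ≤ k → (∀ v ∈ S, p v = i) →
        (G.induce (S : Set V)).edgeSet.ncard ≤ c := by
  -- with `D = n / Q` exceptional vertices, all the error terms are at most `Q * D ≤ n`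
  obtain ⟨L, hL⟩ : ∃ L, L = w + c + 1 := ⟨_, rfl⟩
  obtain ⟨Q, hQ⟩ : ∃ Q, Q = 2 * r + r * (k * (4 + r * L * (c + 4)) + r * w * (c + 4)) := ⟨_, rfl⟩
  obtain ⟨τ, hτ⟩ : ∃ τ, τ = 2 * L * Q := ⟨_, rfl⟩
  obtain ⟨t, ht⟩ : ∃ t, t = (c + 2) * τ + L := ⟨_, rfl⟩
  have hQ0 : 0 < Q := by rw [hQ]; positivity
  have hL0 : 0 < L := by omega
  have hτ0 : 0 < τ := by rw [hτ]; positivity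
  refine ⟨t, Q * (r * (1 + c)) + t * r, fun V _ _ G _ a hn hG ha hdeg => ?_⟩
  obtain ⟨D, hD⟩ : ∃ D, D = Fintype.card V / Q := ⟨_, rfl⟩
  have hDn : Q * D ≤ Fintype.card V := hD ▸ Nat.mul_div_le _ _
  have hD1 : r * (1 + c) ≤ D := by
    rw [hD, Nat.le_div_iff_mul_le hQ0, mul_comm]
    omega
  have hD0 : 1 ≤ D := le_trans (Nat.mul_pos hr (by omega)) hD1
  have hB : IsApproxPartition G (attached G a L τ) c D := by
    refine ⟨fun i j => disjoint_attached a ?_, fun i v => card_adj_attached_le hG ha hτ0 ?_, ?_⟩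
    · nlinarith
    · omega
    · rw [hD, Nat.le_div_iff_mul_le hQ0]
      have h := mul_card_compl_attached_le (τ := τ) hG hr ha hdeg
      rw [← hL] at h
      have h2 : Fintype.card V * L + t * r ≤ 2 * L * Fintype.card V := by
        have h4 : t * r ≤ Fintype.card V := by omega
        have h5 : Fintype.card V ≤ Fintype.card V * L := Nat.le_mul_of_pos_right _ hL0
        linarith
      have h3 : (2 * L) * ((Finset.univ.biUnion (attached G a L τ))ᶜ.card * Q)
          ≤ (2 * L) * Fintype.card V := by
        calc _ = τ * (Finset.univ.biUnion (attached G a L τ))ᶜ.card := by rw [hτ]; ring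
          _ ≤ _ := h.trans h2
      exact Nat.le_of_mul_le_mul_left h3 (by omega)
  choose p hp using hB.exists_card_adj_lt hG hr hdeg hD1
  refine ⟨p, fun i S hSk hSp =>
    hB.ncard_edgeSet_induce_le hG hdeg hD1 ?_ i hSk fun s hs => hSp s hs ▸ hp s⟩
  rw [← hL]
  refine le_trans ?_ hDn
  have e1 : 1 + c + 2 * D + 1 ≤ (c + 4) * D := by nlinarith
  have e2 : 1 + (1 + r * L * (1 + c + 2 * D + 1) + 2 * D) ≤ (4 + r * L * (c + 4)) * D := by
    have := Nat.mul_le_mul_left (r * L) e1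
    nlinarith
  calc _ ≤ 2 * r * D + r * (k * ((4 + r * L * (c + 4)) * D) + r * w * ((c + 4) * D)) := by gcongr
    _ = Q * D := by rw [hQ]; ring

end Approximate

/-! ### Turán numbers -/

section Turan

theorem turanNum_add (r n : ℕ) :
    turanNum r (n + r) = turanNum r n + n * (r - 1) + r.choose 2 :=
  SimpleGraph.card_edgeFinset_turanGraph_add

theorem turanNum_of_le {r n : ℕ} (h : n ≤ r) : turanNum r n = n.choose 2 := by
  have h1 : SimpleGraph.turanGraph n r = ⊤ := SimpleGraph.turanGraph_eq_top.2 (Or.inr h)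
  have h2 := SimpleGraph.card_edgeFinset_top_eq_card_choose_two (V := Fin n)
  rw [turanNum_eq_ncard, h1]
  rwa [Fintype.card_fin, SimpleGraph.edgeFinset, ← Set.ncard_eq_toFinset_card'] at h2

/-- The smallest degree in `T_r(n + 1)` is `n - ⌊n / r⌋`. -/
theorem turanNum_succ {r : ℕ} (hr : 0 < r) (n : ℕ) :
    turanNum r (n + 1) + n / r = turanNum r n + n := by
  induction n using Nat.strong_induction_on with
  | _ n ih =>
    rcases lt_or_ge n r with h | h
    · rw [turanNum_of_le (Nat.succ_le_of_lt h), turanNum_of_le h.le, Nat.div_eq_of_lt h,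
        Nat.choose_succ_succ' n 1, Nat.choose_one_right, add_comm n, Nat.add_zero]
    · obtain ⟨k, rfl⟩ := Nat.exists_eq_add_of_le' h
      have := ih k (by omega)
      rw [show k + r + 1 = k + 1 + r by ring, turanNum_add, turanNum_add, Nat.add_div_right _ hr]
      obtain ⟨q, rfl⟩ : ∃ q, r = q + 1 := ⟨r - 1, by omega⟩
      simp only [Nat.add_sub_cancel]
      linarith

/-- The degree sum of `T_r(n + 1)`: each of the `(n % r + 1) * (n / r + 1)` vertices in the larger
classes has degree one less than `n + 1 - n / r`. -/
theorem two_mul_turanNum_succ {r : ℕ} (hr : 0 < r) (n : ℕ) :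
    2 * turanNum r (n + 1) + n / r * (n + 1) + (n % r + 1) * (n / r + 1) = (n + 1) ^ 2 := by
  induction n with
  | zero => simp [turanNum_of_le (Nat.succ_le_of_lt hr)]
  | succ n ih =>
    have h := turanNum_succ hr (n + 1)
    have hdm := Nat.div_add_mod n r
    have hlt := Nat.mod_lt n hr
    generalize turanNum r (n + 1) = x at *
    generalize turanNum r (n + 1 + 1) = y at *
    generalize n / r = q at *
    generalize n % r = s at *
    rcases Nat.lt_or_ge (s + 1) r with hs | hs
    · have h1 : (n + 1) / r = q := by
        rw [← hdm, add_assoc, Nat.mul_add_div hr, Nat.div_eq_of_lt hs, add_zero]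
      have h2 : (n + 1) % r = s + 1 := by
        rw [← hdm, add_assoc, Nat.mul_add_mod, Nat.mod_eq_of_lt hs]
      rw [h1] at h ⊢
      rw [h2]
      linarith
    · have hs' : s + 1 = r := by omega
      have h0 : n + 1 = r * (q + 1) := by rw [← hdm, add_assoc, hs']; ring
      have h1 : (n + 1) / r = q + 1 := by rw [h0, Nat.mul_div_cancel_left _ hr]
      have h2 : (n + 1) % r = 0 := by rw [h0, Nat.mul_mod_right]
      rw [h1] at h ⊢
      rw [h2]
      rw [hs'] at ih
      linarith

theorem div_le_card_filter_mod_eq {r n : ℕ} (hr : 0 < r) (y : ℕ) :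
    n / r ≤ (Finset.univ.filter fun x : Fin n => (x : ℕ) % r = y % r).card := by
  have hlt : ∀ k : Fin (n / r), r * k + y % r < n := fun k => by
    have h1 := Nat.mod_lt y hr
    have h2 := Nat.mul_div_le n r
    have h3 : r * (k + 1) ≤ r * (n / r) := Nat.mul_le_mul_left _ k.2
    rw [Nat.mul_add] at h3
    omega
  calc n / r = (Finset.univ : Finset (Fin (n / r))).card := by simp
    _ ≤ _ := by
      refine Finset.card_le_card_of_injOn (fun k => ⟨r * k + y % r, hlt k⟩) (fun k _ => ?_) ?_
      · simp
      · intro k _ l _ hkl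
        have h4 := congrArg Fin.val hkl
        simp only [Nat.add_right_cancel_iff] at h4
        exact Fin.ext (Nat.eq_of_mul_eq_mul_left hr h4)

theorem multipartiteGraph_cliqueFree {V : Type*} {r : ℕ} (p : V → Fin r) :
    (multipartiteGraph p).CliqueFree (r + 1) :=
  SimpleGraph.Colorable.cliqueFree
    ⟨SimpleGraph.Coloring.mk p fun {_ _} (h : (multipartiteGraph p).Adj _ _) => h⟩
    (Nat.lt_succ_self r)

variable {V : Type*} [Fintype V] {r : ℕ}

theorem ncard_edgeSet_multipartiteGraph_le (hr : 0 < r) (p : V → Fin r) :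
    (multipartiteGraph p).edgeSet.ncard ≤ turanNum r (Fintype.card V) := by
  classical
  obtain ⟨H, _, hH⟩ := SimpleGraph.exists_isTuranMaximal (V := V) hr
  obtain ⟨e⟩ := (SimpleGraph.isTuranMaximal_iff_nonempty_iso_turanGraph hr).1 hH
  have h := hH.2 (multipartiteGraph_cliqueFree p)
  rw [turanNum_eq_ncard, ← ncard_edgeSet_eq_of_iso e]
  rwa [SimpleGraph.edgeFinset, SimpleGraph.edgeFinset, ← Set.ncard_eq_toFinset_card',
    ← Set.ncard_eq_toFinset_card'] at h

theorem nonempty_iso_turanGraph_of_ncard_eq (hr : 0 < r) (p : V → Fin r)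
    (h : (multipartiteGraph p).edgeSet.ncard = turanNum r (Fintype.card V)) :
    Nonempty (multipartiteGraph p ≃g SimpleGraph.turanGraph (Fintype.card V) r) := by
  classical
  obtain ⟨H, _, hH⟩ := SimpleGraph.exists_isTuranMaximal (V := V) hr
  obtain ⟨e⟩ := (SimpleGraph.isTuranMaximal_iff_nonempty_iso_turanGraph hr).1 hH
  refine (SimpleGraph.isTuranMaximal_iff_nonempty_iso_turanGraph hr).1
    ⟨multipartiteGraph_cliqueFree p, fun G' _ hG' => (hH.2 hG').trans (le_of_eq ?_)⟩
  rw [turanNum_eq_ncard, ← ncard_edgeSet_eq_of_iso e] at h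
  rw [SimpleGraph.edgeFinset, SimpleGraph.edgeFinset, ← Set.ncard_eq_toFinset_card',
    ← Set.ncard_eq_toFinset_card', h]

/-- The classes of a complete multipartite graph isomorphic to a Turán graph are not too small. -/
theorem div_le_card_class {n : ℕ} (hr : 0 < r) {p : V → Fin r}
    (e : multipartiteGraph p ≃g SimpleGraph.turanGraph n r) (v : V) :
    n / r ≤ (Finset.univ.filter fun u => p u = p v).card := by
  refine (div_le_card_filter_mod_eq hr (e v)).trans ?_
  refine Finset.card_le_card_of_injOn e.symm (fun x hx => ?_) e.symm.injective.injOn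
  have hx : (x : ℕ) % r = (e v : ℕ) % r := by simpa using hx
  have h1 : ¬ (multipartiteGraph p).Adj (e.symm x) v := by
    rw [← e.map_adj_iff, e.apply_symm_apply, SimpleGraph.turanGraph_adj]
    exact not_not.2 hx
  simpa [multipartiteGraph] using h1

end Turan

/-! ### Degrees of extremal graphs -/

section Degree

variable {V W : Type*} [Fintype V] {r : ℕ} {F : SimpleGraph W} {G : SimpleGraph V}
  [DecidableRel G.Adj]

theorem card_filter_not_adj (v : V) :
    (Finset.univ.filter fun u => ¬ G.Adj v u).card + G.degree v = Fintype.card V := by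
  rw [add_comm, ← SimpleGraph.card_neighborFinset_eq_degree, SimpleGraph.neighborFinset_eq_filter]
  exact Finset.card_filter_add_card_filter_not _

theorem ncard_edgeSet_le_extremalNumber_add_degree (hG : F.Free G) (v : V) :
    G.edgeSet.ncard ≤ SimpleGraph.extremalNumber (Fintype.card V - 1) F + G.degree v := by
  classical
  have h := SimpleGraph.card_edgeFinset_deleteIncidenceSet_le_extremalNumber hG v
  rw [SimpleGraph.card_edgeFinset_deleteIncidenceSet] at h
  rw [Set.ncard_eq_toFinset_card']
  change G.edgeFinset.card ≤ _
  omega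

/-- Deleting a vertex of an extremal graph shows that no degree is below the smallest degree of
the Turán graph. -/
theorem card_not_adj_le_of_extremal {m : ℕ} {c : ℤ} (hr : 0 < r) (hV : Fintype.card V = m + 1)
    (hG : F.Free G) (he : (G.edgeSet.ncard : ℤ) = turanNum r (m + 1) + c)
    (hex : (SimpleGraph.extremalNumber m F : ℤ) ≤ turanNum r m + c) (v : V) :
    (Finset.univ.filter fun u => ¬ G.Adj v u).card ≤ m / r + 1 := by
  have h1 := ncard_edgeSet_le_extremalNumber_add_degree hG v
  have h2 := card_filter_not_adj (G := G) v
  have h3 := turanNum_succ hr m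
  rw [hV, Nat.add_sub_cancel] at h1
  omega

/-- Some degree is at most the smallest degree of the Turán graph, by averaging; deleting such a
vertex bounds `ex(m, F)` from below. -/
theorem turanNum_add_le_extremalNumber {m : ℕ} {c : ℤ} (hr : 0 < r)
    (hV : Fintype.card V = m + 1)
    (hG : F.Free G) (he : (G.edgeSet.ncard : ℤ) = turanNum r (m + 1) + c)
    (hm : 2 * c < m / r + 1) :
    (turanNum r m : ℤ) + c ≤ SimpleGraph.extremalNumber m F := by
  obtain ⟨v, hv⟩ : ∃ v, G.degree v + m / r ≤ m := by
    by_contra! hcon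
    have h1 := G.sum_degrees_eq_twice_card_edges
    rw [SimpleGraph.edgeFinset, ← Set.ncard_eq_toFinset_card'] at h1
    have h2 := Finset.sum_le_sum fun v (_ : v ∈ Finset.univ) => Nat.succ_le_of_lt (hcon v)
    simp only [Nat.succ_eq_add_one, Finset.sum_add_distrib, Finset.sum_const, Finset.card_univ,
      hV, smul_eq_mul] at h2
    rw [h1] at h2
    have h3 := two_mul_turanNum_succ hr m
    have h4 : m / r + 1 ≤ (m % r + 1) * (m / r + 1) := Nat.le_mul_of_pos_left _ (Nat.succ_pos _)
    zify at h2 h3 h4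
    nlinarith
  have h1 := ncard_edgeSet_le_extremalNumber_add_degree hG v
  have h3 := turanNum_succ hr m
  rw [hV, Nat.add_sub_cancel] at h1
  omega

/-- The minimum degree form of the Erdős–Stone theorem, in terms of blocks. -/
theorem exists_isBlock (r t : ℕ) (hr : 2 ≤ r) :
    ∃ N : ℕ, ∀ (V : Type*) [Fintype V] (G : SimpleGraph V) [DecidableRel G.Adj],
      N ≤ Fintype.card V →
      (∀ v, r * (Finset.univ.filter fun u => ¬ G.Adj v u).card ≤ Fintype.card V + r) →
      ∃ a : Fin r → Fin t → V, IsBlock G a := by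
  obtain ⟨q, rfl⟩ : ∃ q, r = q + 1 := ⟨r - 1, by omega⟩
  have hq : 0 < q := by omega
  have hqR : (0 : ℝ) < q := by exact_mod_cast hq
  have hε : (0 : ℝ) < 1 / (2 * q * (q + 1)) := by positivity
  obtain ⟨N, hN⟩ := eventually_atTop.1
    (SimpleGraph.eventually_completeEquipartiteGraph_isContained_of_minDegree hε q t)
  refine ⟨max N (2 * q * (q + 1)), fun V _ G _ hn hdeg => ?_⟩
  classical
  obtain ⟨n, hV⟩ : ∃ n, Fintype.card V = n := ⟨_, rfl⟩
  rw [hV] at hn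
  have hn1 : N ≤ n := le_of_max_le_left hn
  have hn2 : 2 * q * (q + 1) ≤ n := le_of_max_le_right hn
  have hn0 : 0 < n := lt_of_lt_of_le (by positivity) hn2
  let e := Fintype.equivFinOfCardEq hV
  let φ : G ≃g G.map e.toEmbedding := SimpleGraph.Iso.map e G
  have hne : Nonempty V := Fintype.card_pos_iff.1 (hV ▸ hn0)
  obtain ⟨f⟩ := hN n hn1 (G := G.map e.toEmbedding) (by
    rw [← φ.minDegree_eq]
    obtain ⟨v, hv⟩ := G.exists_minimal_degree_vertex
    rw [hv]
    have h1 := card_filter_not_adj (G := G) v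
    have h2 := hdeg v
    rw [hV] at h1 h2
    have h3 : ((q : ℝ) + 1) * n ≤ (q + 1) * G.degree v + n + (q + 1) := by
      have h4 : (q + 1) * n ≤ (q + 1) * G.degree v + n + (q + 1) := by nlinarith
      exact_mod_cast h4
    have h5 : (2 * q * (q + 1) : ℝ) ≤ n := by exact_mod_cast hn2
    have h6 : (1 - 1 / (q : ℝ) + 1 / (2 * q * (q + 1))) * n
        = n * (2 * q * q - 1) / (2 * q * (q + 1)) := by
      field_simp
      ring
    rw [ge_iff_le, h6, div_le_iff₀ (by positivity)]
    nlinarith)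
  refine ⟨fun i x => φ.symm (f (i, x)), fun i x y h => ?_, fun i j x y h => ?_⟩
  · simpa using f.injective (φ.symm.injective h)
  · exact φ.symm.map_adj_iff.2 (f.toHom.map_adj h)

end Degree

/-! ### The partition of an extremal graph -/

section Extremal

/-- The upper limit `c₀` of the integers `ex(n, F) - t_r(n)` is an eventual upper bound. -/
theorem exists_forall_extremalNumber_le {W : Type*} {r : ℕ} {F : SimpleGraph W}
    (hF : ExIsTuranPlusO1 r F) :
    ∃ n₀ : ℕ, ∀ n, n₀ ≤ n →
      (SimpleGraph.extremalNumber n F : ℤ) ≤ turanNum r n + turanExcess r F := by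
  obtain ⟨C, hC⟩ := hF.bound
  have hbdd : IsBoundedUnder (· ≤ ·) atTop
      (fun n : ℕ => (SimpleGraph.extremalNumber n F : ℤ) - (turanNum r n : ℤ)) := by
    refine ⟨⌊C⌋, eventually_map.2 (hC.mono fun n hn => ?_)⟩
    refine Int.le_floor.2 ?_
    push_cast
    rw [norm_one, mul_one, Real.norm_eq_abs] at hn
    exact (le_abs_self _).trans hn
  have h := eventually_lt_of_limsup_lt (lt_add_one (turanExcess r F)) hbdd
  obtain ⟨n₀, h⟩ := eventually_atTop.1 h
  exact ⟨n₀, fun n hn => by have := h n hn; omega⟩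

theorem ncard_edgeSet_induce_of_subset {V : Type*} {H : SimpleGraph V} {s : Set V}
    (h : ∀ e ∈ H.edgeSet, ∀ x ∈ e, x ∈ s) : (H.induce s).edgeSet.ncard = H.edgeSet.ncard := by
  rw [ncard_edgeSet_induce]
  congr 1
  ext e
  exact ⟨fun he => he.1, fun he => ⟨he, h e he⟩⟩

variable {V W : Type*} [Fintype W] {r : ℕ} {F : SimpleGraph W} {G : SimpleGraph V}

/-- Planting the empty graph: an `F`-free graph that contains a block with classes of size `|W|`
forces large Turán graphs to be `F`-free. -/
theorem extremal_excess_nonneg (hr : 0 < r) {n₀ : ℕ} {c : ℤ}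
    (hex : ∀ n, n₀ ≤ n → (SimpleGraph.extremalNumber n F : ℤ) ≤ turanNum r n + c)
    (hG : F.Free G) {a : Fin r → Fin (Fintype.card W) → V} (ha : IsBlock G a) : 0 ≤ c := by
  have h := ncard_innerGraph_le_ncard_missingGraph_add hr hex hG (S := Empty) (H := ⊥)
    Empty.elim (f := Empty.elim) (fun a => a.elim) (fun a => a.elim)
    (ρ := fun j x => a j (Fintype.equivFin W x))
    (fun j => (ha.1 j).comp (Equiv.injective _)) (fun j k x y h => ha.2 _ _ _ _ h)
    (fun _ _ s => s.elim) (fun _ _ s => s.elim)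
  have h2 : missingGraph (⊥ : SimpleGraph Empty) (r := r) Empty.elim = ⊥ := by
    ext a; exact a.elim
  rw [h2, SimpleGraph.edgeSet_bot, Set.ncard_empty] at h
  omega

variable [Fintype V]

/-- Planting the graph spanned by a set of vertices of a single class. -/
theorem locallySparse_of_free (hr : 0 < r) {n₀ c : ℕ}
    (hex : ∀ n, n₀ ≤ n → (SimpleGraph.extremalNumber n F : ℤ) ≤ turanNum r n + c)
    (hG : F.Free G) : LocallySparse G r (Fintype.card W) c := by
  intro S i ρ hρ hρS hadj
  have h := ncard_innerGraph_le_ncard_missingGraph_add hr hex hG (H := G.induce (S : Set V))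
    (fun _ => i) Subtype.val_injective (fun a b h => h)
    (ρ := fun j x => ρ j (Fintype.equivFin W x))
    (fun j => (hρ.1 j).comp (Equiv.injective _)) (fun j k x y h => hρ.2 _ _ _ _ h)
    (fun j x s h => hρS _ _ (h ▸ s.2)) (fun j x s h => hadj j _ h s s.2)
  have h1 : innerGraph (G.induce (S : Set V)) (fun _ => i) = G.induce (S : Set V) := by
    ext; simp [innerGraph]
  have h2 : missingGraph (G.induce (S : Set V)) (fun _ => i) = ⊥ := by
    ext; simp [missingGraph]
  rw [h1, h2, SimpleGraph.edgeSet_bot, Set.ncard_empty] at h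
  omega

theorem ncard_innerGraph_le {c : ℕ} {p : V → Fin r} (hp : ClassesSpanAtMost G p c) :
    (innerGraph G p).edgeSet.ncard ≤ r * c := by
  calc (innerGraph G p).edgeSet.ncard
      ≤ (⋃ i, {e ∈ G.edgeSet | ∀ x ∈ e, x ∈ {v | p v = i}}).ncard := by
        refine Set.ncard_le_ncard fun e he => ?_
        induction e with | _ x y
        have he : G.Adj x y ∧ p x = p y := he
        refine Set.mem_iUnion.2 ⟨p x, he.1, ?_⟩
        simp [he.2]
    _ ≤ ∑ i, {e ∈ G.edgeSet | ∀ x ∈ e, x ∈ {v | p v = i}}.ncard :=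
        Set.ncard_iUnion_le_of_fintype _
    _ ≤ ∑ _i : Fin r, c := Finset.sum_le_sum fun i _ => by
        rw [← ncard_edgeSet_induce]
        exact_mod_cast hp i
    _ = r * c := by simp

/-- When the classes are large, `e(G_in) ≤ e(G_out) + c`: the inner and missing edges touch only
few vertices, and these can be planted. -/
theorem innerGraph_le_missingGraph_add_of_card_le (hr : 0 < r) {n₀ : ℕ} {c : ℤ}
    (hex : ∀ n, n₀ ≤ n → (SimpleGraph.extremalNumber n F : ℤ) ≤ turanNum r n + c)
    (hG : F.Free G) {p : V → Fin r}
    (hp : ∀ i, 2 * ((innerGraph G p).edgeSet.ncard + (missingGraph G p).edgeSet.ncard)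
      + Fintype.card W ≤ (Finset.univ.filter fun v => p v = i).card) :
    ((innerGraph G p).edgeSet.ncard : ℤ) ≤ (missingGraph G p).edgeSet.ncard + c := by
  classical
  let E := (innerGraph G p).edgeFinset ∪ (missingGraph G p).edgeFinset
  let S := E.biUnion Sym2.toFinset
  have hS : S.card
      ≤ 2 * ((innerGraph G p).edgeSet.ncard + (missingGraph G p).edgeSet.ncard) := by
    rw [Set.ncard_eq_toFinset_card', Set.ncard_eq_toFinset_card', mul_comm]
    refine (Finset.card_biUnion_le_card_mul _ _ 2 fun e _ => ?_).trans
      (Nat.mul_le_mul_right _ (Finset.card_union_le _ _))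
    rw [Sym2.card_toFinset]
    split_ifs <;> omega
  have hin : ∀ e ∈ (innerGraph G p).edgeSet, ∀ x ∈ e, x ∈ (S : Set V) := fun e he x hx =>
    Finset.mem_biUnion.2 ⟨e, Finset.mem_union_left _ (SimpleGraph.mem_edgeFinset.2 he),
      Sym2.mem_toFinset.2 hx⟩
  have hout : ∀ e ∈ (missingGraph G p).edgeSet, ∀ x ∈ e, x ∈ (S : Set V) := fun e he x hx =>
    Finset.mem_biUnion.2 ⟨e, Finset.mem_union_right _ (SimpleGraph.mem_edgeFinset.2 he),
      Sym2.mem_toFinset.2 hx⟩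
  have hadj : ∀ u v, u ∉ S → p u ≠ p v → G.Adj u v := fun u v hu huv => by
    by_contra hns
    exact hu (hout s(u, v) ⟨hns, huv⟩ u (by simp))
  have hne : ∀ i, Nonempty (W ↪ ↥((Finset.univ.filter fun v => p v = i) \ S)) := fun i => by
    refine Function.Embedding.nonempty_of_card_le ?_
    rw [Fintype.card_coe]
    have h1 := Finset.le_card_sdiff S (Finset.univ.filter fun v => p v = i)
    have h2 := hp i
    omega
  let ρ := fun i => (hne i).some
  have hρ1 : ∀ i x, p (ρ i x) = i := fun i x =>
    (Finset.mem_filter.1 (Finset.mem_sdiff.1 (ρ i x).2).1).2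
  have hρ2 : ∀ i x, (ρ i x : V) ∉ S := fun i x => (Finset.mem_sdiff.1 (ρ i x).2).2
  have h := ncard_innerGraph_le_ncard_missingGraph_add hr hex hG (H := G.induce (S : Set V))
    (fun s => p s) Subtype.val_injective (fun a b h => h)
    (ρ := fun j x => (ρ j x : V))
    (fun j x y h => (ρ j).injective (Subtype.ext h))
    (fun j k x y h => hadj _ _ (hρ2 _ _) (by rwa [hρ1, hρ1]))
    (fun j x s h => hρ2 j x (h ▸ s.2)) (fun j x s h => hadj _ _ (hρ2 _ _) (by rwa [hρ1]))
  have h1 : innerGraph (G.induce (S : Set V)) (fun s => p s)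
    = (innerGraph G p).induce (S : Set V) := rfl
  have h2 : missingGraph (G.induce (S : Set V)) (fun s => p s)
    = (missingGraph G p).induce (S : Set V) := rfl
  rwa [h1, h2, ncard_edgeSet_induce_of_subset hin, ncard_edgeSet_induce_of_subset hout] at h

/-- In a graph that is nearly complete between large classes, the partition into sparse classes is
unique: each class meets some class of the other partition in more than `2 * c + 1` vertices, and
no vertex of another class can lie in the latter. -/
theorem exists_perm_of_classesSpanAtMost [DecidableRel G.Adj] {c : ℕ}
    {p q : V → Fin r}
    (hout : ∀ v, ((missingGraph G p).neighborSet v).ncard ≤ c + 1)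
    (hp : ∀ i, r * (2 * c + 2) ≤ (Finset.univ.filter fun v => p v = i).card)
    (hq : ClassesSpanAtMost G q c) : ∃ σ : Equiv.Perm (Fin r), ∀ v, q v = σ (p v) := by
  have h1 : ∀ i, ∃ j, 2 * c + 2 ≤ ((Finset.univ.filter fun v => p v = i).filter
      fun v => q v = j).card := fun i => by
    obtain ⟨j, -, hj⟩ := Finset.exists_le_card_fiber_of_mul_le_card_of_maps_to
      (s := Finset.univ.filter fun v => p v = i) (t := Finset.univ) (f := q)
      (fun _ _ => Finset.mem_univ _) ⟨i, Finset.mem_univ i⟩ (n := 2 * c + 2) (by simpa using hp i)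
    exact ⟨j, hj⟩
  choose σ hσ using h1
  have h2 : ∀ v i, q v = σ i → p v = i := by
    intro v i hv
    by_contra hne
    let X := (Finset.univ.filter fun v => p v = i).filter fun v => q v = σ i
    have hXi : ∀ u ∈ X, p u = i ∧ q u = σ i := fun u hu => by simpa [X] using hu
    have h3 := Finset.card_filter_add_card_filter_not (s := X) (fun u => G.Adj v u)
    have h4 : (X.filter fun u => ¬ G.Adj v u).card ≤ c + 1 := by
      rw [← Set.ncard_coe_finset]
      refine (Set.ncard_le_ncard fun u hu => ?_).trans (hout v)
      have hu := Finset.mem_filter.1 hu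
      exact ⟨hu.2, by rwa [(hXi u hu.1).1]⟩
    have h5 := card_le_ncard_edgeSet_induce G (s := {u | q u = σ i}) (v := v)
      (T := X.filter fun u => G.Adj v u) hv (fun u hu => (hXi u (Finset.mem_filter.1 hu).1).2)
      (fun u hu => (Finset.mem_filter.1 hu).2)
    have h6 := hq (σ i)
    have h7 : 2 * c + 2 ≤ X.card := hσ i
    omega
  have hinj : Function.Injective σ := fun i j hij => by
    obtain ⟨v, hv⟩ := Finset.card_pos.1 (lt_of_lt_of_le (Nat.succ_pos _) (hσ i))
    have hv' : p v = i ∧ q v = σ i := by simpa using hv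
    rw [← hv'.1]
    exact h2 v j (hv'.2.trans hij)
  refine ⟨Equiv.ofBijective σ hinj.bijective_of_finite, fun v => ?_⟩
  obtain ⟨i, hi⟩ := hinj.bijective_of_finite.2 (q v)
  rw [Equiv.ofBijective_apply, h2 v i hi.symm, hi]

end Extremal

theorem corollary3p3 {W : Type*} [Finite W] (F : SimpleGraph W) (r : ℕ) (hr : 2 ≤ r)
    (hF : ExIsTuranPlusO1 r F) :
    ∃ N : ℕ, ∀ n : ℕ, N ≤ n →
      (SimpleGraph.extremalNumber n F : ℤ) = (turanNum r n : ℤ) + turanExcess r F →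
      ∀ (V : Type*) [Fintype V] (G : SimpleGraph V), Fintype.card V = n → F.Free G →
        G.edgeSet.ncard = SimpleGraph.extremalNumber n F →
        (SimpleGraph.extremalNumber (n - 1) F : ℤ)
            = (turanNum r (n - 1) : ℤ) + turanExcess r F ∧
        ∃ p : V → Fin r,
          -- the partition associated with `G`, unique up to relabelling the classes
          ClassesSpanAtMost G p (turanExcess r F) ∧
          (∀ q : V → Fin r, ClassesSpanAtMost G q (turanExcess r F) →
            ∃ σ : Equiv.Perm (Fin r), ∀ v : V, q v = σ (p v)) ∧
          -- its complete multipartite graph is a Turán graph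
          Nonempty (multipartiteGraph p ≃g SimpleGraph.turanGraph n r) ∧
          G = crossGraph G p ⊔ innerGraph G p ∧
          crossGraph G p ≤ multipartiteGraph p ∧
          innerGraph G p ≤ (multipartiteGraph p)ᶜ ∧
          ((innerGraph G p).edgeSet.ncard : ℤ) - ((missingGraph G p).edgeSet.ncard : ℤ)
            = turanExcess r F ∧
          ∀ v : V, (((missingGraph G p).neighborSet v).ncard : ℤ) ≤ turanExcess r F + 1 := by
  classical
  have := Fintype.ofFinite W
  have hr0 : 0 < r := by omega
  obtain ⟨n₀, hex⟩ := exists_forall_extremalNumber_le hF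
  generalize turanExcess r F = c₀ at hex ⊢
  -- `c = c₀` once `0 ≤ c₀` is known, which needs a block in `G`
  obtain ⟨c, hc⟩ : ∃ c, c = c₀.toNat := ⟨_, rfl⟩
  obtain ⟨t, N₁, hpart⟩ := exists_partition_of_isBlock r (Fintype.card W) c (2 * (c + 1)) hr0
  obtain ⟨N₂, hblock⟩ := exists_isBlock r t hr
  obtain ⟨N₃, hblock'⟩ := exists_isBlock r (Fintype.card W) hr
  -- the classes have at least `M` vertices when `n ≥ 2 r² (1 + c) + r M`
  obtain ⟨M, hM⟩ : ∃ M, M = r * (2 * c + 2) + (2 * (2 * (r * c)) + Fintype.card W) := ⟨_, rfl⟩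
  refine ⟨n₀ + N₁ + N₂ + N₃ + 2 * r * (r * (1 + c)) + r * M + 2 * c * r + 1,
    fun n hn hexn V _ G hV hG he => ?_⟩
  obtain ⟨m, rfl⟩ : ∃ m, n = m + 1 := ⟨n - 1, by omega⟩
  rw [Nat.add_sub_cancel]
  have heZ : (G.edgeSet.ncard : ℤ) = turanNum r (m + 1) + c₀ := by rw [he, hexn]
  have hexm := hex m (by omega)
  have hdeg' := card_not_adj_le_of_extremal hr0 hV hG heZ hexm
  have hdiv := Nat.mul_div_le m r
  have hdeg : ∀ v, r * (Finset.univ.filter fun u => ¬ G.Adj v u).card ≤ Fintype.card V + r := by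
    intro v
    have h := Nat.mul_le_mul_left r (hdeg' v)
    rw [Nat.mul_add] at h
    omega
  obtain ⟨a, ha⟩ := hblock V G (by omega) hdeg
  obtain ⟨a', ha'⟩ := hblock' V G (by omega) hdeg
  have hc₀ : 0 ≤ c₀ := extremal_excess_nonneg hr0 hex hG ha'
  obtain rfl : (c : ℤ) = c₀ := by rw [hc, Int.toNat_of_nonneg hc₀]
  have hsparse := locallySparse_of_free hr0 hex hG
  obtain ⟨p, hp⟩ := hpart V G a (by omega) hsparse ha hdeg
  have hspan : ClassesSpanAtMost G p c := by
    intro i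
    by_contra! hcon
    obtain ⟨S, hSs, hSc, hS⟩ := exists_finset_ncard_edgeSet_induce_gt G (s := {v | p v = i})
      (c := c) (by exact_mod_cast hcon)
    exact absurd (hp i S hSc hSs) (not_le.2 hS)
  -- the classes form an approximate partition without exceptional vertices
  have happrox : IsApproxPartition G (fun i => Finset.univ.filter fun v => p v = i) c
      (r * (1 + c)) := by
    refine ⟨fun i j hij => ?_, fun i v hv => ?_, ?_⟩
    · rw [Finset.disjoint_filter]
      exact fun v _ h1 h2 => hij (h1.symm.trans h2)
    · have h := card_le_ncard_edgeSet_induce G (s := {u | p u = i}) (v := v)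
        (T := (Finset.univ.filter fun u => p u = i).filter fun u => G.Adj v u)
        (by simpa using hv) (fun u hu => by simpa using (Finset.mem_filter.1 hu).1)
        (fun u hu => (Finset.mem_filter.1 hu).2)
      exact_mod_cast (Nat.cast_le.2 h).trans (hspan i)
    · have h : Finset.univ.biUnion (fun i => Finset.univ.filter fun v => p v = i)
          = Finset.univ := by ext; simp
      simp [h]
  have hclass : ∀ i, M ≤ (Finset.univ.filter fun v => p v = i).card := fun i => by
    have h := happrox.card_le_mul_card_add hdeg le_rfl i
    exact Nat.le_of_mul_le_mul_left (by omega) hr0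
  have hin := ncard_innerGraph_le hspan
  have hcount := ncard_edgeSet_add_missingGraph G p
  have hturan := ncard_edgeSet_multipartiteGraph_le hr0 p
  rw [hV] at hturan
  have hupper := innerGraph_le_missingGraph_add_of_card_le hr0 hex hG (p := p) fun i => by
    have h := hclass i
    omega
  -- `e(G) = e(T) + e(G_in) - e(G_out)`, `e(T) ≤ t_r(n)` and `e(G_in) - e(G_out) ≤ c` force equality
  obtain ⟨e⟩ := nonempty_iso_turanGraph_of_ncard_eq hr0 p (by rw [hV]; omega)
  rw [hV] at e
  -- `v` misses at most `⌊n / r⌋ + 1` vertices, of which at least `⌊n / r⌋ - c` in its own class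
  have hout : ∀ v, ((missingGraph G p).neighborSet v).ncard ≤ c + 1 := by
    intro v
    have h1 := hdeg' v
    have h2 := div_le_card_class hr0 e v
    have h3 := happrox.card_adj_le (p v) v (by simp)
    have h4 := Finset.card_filter_add_card_filter_not
      (s := Finset.univ.filter fun u => p u = p v) (fun u => G.Adj v u)
    have h5 : (missingGraph G p).neighborSet v
        = (((Finset.univ.filter fun u => ¬ G.Adj v u).filter fun u => p u ≠ p v : Finset V)) := by
      ext u
      simp [missingGraph, ne_comm]
    have h6 := Finset.card_filter_add_card_filter_not
      (s := Finset.univ.filter fun u => ¬ G.Adj v u) (fun u => p u = p v)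
    have h7 : m / r ≤ (m + 1) / r := Nat.div_le_div_right (Nat.le_succ m)
    rw [h5, Set.ncard_coe_finset]
    rw [Finset.filter_filter] at h4 h6 ⊢
    simp only [Finset.filter_filter, and_comm] at h3 h4 h6 ⊢
    simp only [ne_eq] at h6 ⊢
    omega
  refine ⟨le_antisymm hexm (turanNum_add_le_extremalNumber hr0 hV hG heZ ?_), p, hspan,
    fun q hq => exists_perm_of_classesSpanAtMost hout (fun i => ?_) hq, ⟨e⟩,
    (crossGraph_sup_innerGraph G p).symm, fun u v h => h.2,
    innerGraph_le_compl_multipartiteGraph G p, by omega, fun v => by exact_mod_cast hout v⟩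
  · have h : 2 * c ≤ m / r := by
      rw [Nat.le_div_iff_mul_le hr0]
      omega
    exact_mod_cast Nat.lt_succ_of_le h
  · exact le_trans (by omega) (hclass i)
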